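/- Let $\mathbb{K}$ be a field and let $F \in \mathbb{K}[x]^{m\times n}$ have rank $r$. Degrees take values in $\mathbb{Z}\cup\{-\infty\}$, with $\deg 0=-\infty$ (and $0\cdot(-\infty)=0$). The degree $\deg F$ of a matrix is the largest degree of its entries, and $\operatorname{rdeg} F$ is the list of the degrees of its rows. For a shift $s=(s_1,\dots,s_m)\in\mathbb{Z}^m$, the $s$-degree of a row $p\in\mathbb{K}[x]^{1\times m}$ is $\max_{j}(s_j+\deg p_j)$, and $\operatorname{rdeg}_s$ of a matrix is the list of the $s$-degrees of its rows. The $s$-pivot index of a nonzero row $p$ is the largest $j$ for which $s_j+\deg p_j$ equals the $s$-degree of $p$, and $\deg p_j$ is then its $s$-pivot degree. A matrix is in $s$-weak Popov form if it has no zero row and the $s$-pivot indices of its rows are strictly increasing. We write $|t|$ for the sum of the entries of a tuple $t$, and $A_I$ for the submatrix of $A$ formed by the rows with index in $I$ (in increasing order). Let $s\in\mathbb{Z}^m$ and let $K\in\mathbb{K}[x]^{(m-r)\times m}$ be a matrix in $s$-weak Popov form whose rows form a basis of the left kernel $\{p\in\mathbb{K}[x]^{1\times m} : pF=0\}$. Let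 $\pi$ and $\delta$ be the tuples of $s$-pivot indices and $s$-pivot degrees of the rows of $K$, and let $\pi^c=\{1,\dots,m\}\setminus\pi$. Suppose that $F=SR$ with $S\in\mathbb{K}[x]^{m\times r}$ and $R\in\mathbb{K}[x]^{r\times n}$. Then: (i) $\pi^c$ has $r$ elements, and $F_{\pi^c}\in\mathbb{K}[x]^{r\times n}$ has rank $r$. (ii) $S_{\pi^c}\in\mathbb{K}[x]^{r\times r}$ is nonsingular, and $$|\delta|\ \le\ \deg\det(S_{\pi^c})\ \le\ |\operatorname{rdeg} F_{\pi^c}|\ \le\ r\deg F .$$ (iii) If $s\ge\operatorname{rdeg} F$ entrywise, then $|\operatorname{rdeg}_s K|\le|s|$. -/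

import Mathlib

namespace PolyMat

variable {𝕜 : Type*} [Field 𝕜] {k m n r : ℕ}

/-- The degree of a polynomial as an element of `ℤ ∪ {-∞}`; the zero polynomial has
degree `-∞ = ⊥`. -/
def deg (p : Polynomial 𝕜) : WithBot ℤ :=
  p.degree.map (fun d : ℕ => (d : ℤ))

/-- The degree of a row vector: the largest degree of its entries (`⊥` for a zero row). -/
def rowDeg (p : Fin n → Polynomial 𝕜) : WithBot ℤ :=
  Finset.univ.sup fun j => deg (p j)

/-- The `s`-degree of a row vector: the maximum of `s j + deg (p j)` (`⊥` for a zero row). -/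
def shiftedRowDeg (s : Fin n → ℤ) (p : Fin n → Polynomial 𝕜) : WithBot ℤ :=
  Finset.univ.sup fun j => (s j : WithBot ℤ) + deg (p j)

/-- The degree of a matrix: the largest degree of its entries. -/
def matDeg (A : Matrix (Fin m) (Fin n) (Polynomial 𝕜)) : WithBot ℤ :=
  Finset.univ.sup fun i => rowDeg (A i)

/-- `j` is the `s`-pivot index of the (nonzero) row `p`: the largest index at which the
`s`-degree of `p` is attained. -/
def IsPivotIndex (s : Fin n → ℤ) (p : Fin n → Polynomial 𝕜) (j : Fin n) : Prop :=
  p ≠ 0 ∧ IsGreatest {l : Fin n | (s l : WithBot ℤ) + deg (p l) = shiftedRowDeg s p} j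

/-- `(π, δ)` is the `s`-pivot profile of `P`: `π i` is the `s`-pivot index of row `i`, and
`δ i` is its `s`-pivot degree, the degree of the pivot entry. -/
def IsPivotProfile (s : Fin n → ℤ) (P : Matrix (Fin k) (Fin n) (Polynomial 𝕜))
    (π : Fin k → Fin n) (δ : Fin k → ℕ) : Prop :=
  ∀ i, IsPivotIndex s (P i) (π i) ∧ (P i (π i)).degree = (δ i : WithBot ℕ)

/-- `P` is in (ordered) `s`-weak Popov form: it has no zero row and its `s`-pivot indices are
strictly increasing. -/
def IsWeakPopov (s : Fin n → ℤ) (P : Matrix (Fin k) (Fin n) (Polynomial 𝕜)) : Prop :=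
  (∀ i, P i ≠ 0) ∧ ∃ π : Fin k → Fin n, (∀ i, IsPivotIndex s (P i) (π i)) ∧ StrictMono π

/-- The left kernel `{p | p F = 0}`. -/
noncomputable def leftKernel (F : Matrix (Fin m) (Fin n) (Polynomial 𝕜)) :
    Submodule (Polynomial 𝕜) (Fin m → Polynomial 𝕜) :=
  LinearMap.ker F.vecMulLinear

/-- The rows of `P` form a basis of the module `M`. -/
def RowsFormBasis (P : Matrix (Fin k) (Fin n) (Polynomial 𝕜))
    (M : Submodule (Polynomial 𝕜) (Fin n → Polynomial 𝕜)) : Prop :=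
  LinearIndependent (Polynomial 𝕜) (fun i => P i) ∧
    Submodule.span (Polynomial 𝕜) (Set.range fun i => P i) = M

/-- The set of indices that do not occur in the tuple `π`. -/
def complIndices (π : Fin k → Fin m) : Finset (Fin m) :=
  (Finset.univ.image π)ᶜ

/-- The submatrix of `A` formed by the `r` rows with index in `I`, in increasing order. -/
def selectRows (A : Matrix (Fin m) (Fin n) (Polynomial 𝕜)) (I : Finset (Fin m))
    (hI : I.card = r) : Matrix (Fin r) (Fin n) (Polynomial 𝕜) :=
  A.submatrix (I.orderEmbOfFin hI) id

end PolyMat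

namespace Matrix

theorem submatrix_mul_add_submatrix_mul {R : Type*} [CommRing R] {ι κ μ ν ρ : Type*} [Fintype ι]
    [Fintype κ] [Fintype μ] (e : ι ⊕ κ ≃ μ) (A : Matrix ν μ R) (B : Matrix μ ρ R) :
    A.submatrix id (e ∘ Sum.inl) * B.submatrix (e ∘ Sum.inl) id +
      A.submatrix id (e ∘ Sum.inr) * B.submatrix (e ∘ Sum.inr) id = A * B := by
  ext i j
  simp only [add_apply, mul_apply, submatrix_apply, id, Function.comp]
  rw [← Equiv.sum_comp e, Fintype.sum_sum_type]

section Domain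

variable {R : Type*} [CommRing R] [IsDomain R]

theorem det_ne_zero_of_mulVec_injective {ι : Type*} [Fintype ι] [DecidableEq ι]
    {A : Matrix ι ι R} (h : Function.Injective A.mulVec) : A.det ≠ 0 := by
  intro h0
  obtain ⟨v, hv, hAv⟩ := exists_mulVec_eq_zero_iff.mpr h0
  exact hv (h (by simpa using hAv))

/-- A matrix of full row rank over a domain has a nonzero maximal minor. -/
theorem exists_det_submatrix_ne_zero {n r : ℕ} (A : Matrix (Fin r) (Fin n) R)
    (hA : A.rank = r) : ∃ J : Fin r → Fin n, (A.submatrix id J).det ≠ 0 := by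
  classical
  obtain ⟨t, hind, hmax⟩ := exists_maximal_linearIndepOn R A.col
  have hmul : ∀ j, ∃ a : R, a ≠ 0 ∧ a • A.col j ∈ Submodule.span R (A.col '' t) := by
    intro j
    by_cases hj : j ∈ t
    · exact ⟨1, one_ne_zero, by
        rw [one_smul]; exact Submodule.subset_span (Set.mem_image_of_mem _ hj)⟩
    · exact hmax j hj
  choose a ha0 ha using hmul
  have hc : (∏ j, a j) ≠ 0 := Finset.prod_ne_zero_iff.mpr fun j _ => ha0 j
  have hspan : Set.range (fun j : t => A.col j) = A.col '' t := by
    rw [Set.image_eq_range]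
  have hfin : Module.finrank R (Submodule.span R (A.col '' t)) = Fintype.card t := by
    rw [← hspan]
    exact finrank_span_eq_card hind
  have hle : r ≤ Fintype.card t := by
    refine hA.symm.trans_le ?_
    rw [← hfin, ← rank_smul_of_mem_nonZeroDivisors A (mem_nonZeroDivisors_of_ne_zero hc),
      rank_eq_finrank_span_cols]
    have : Module.Finite R (Submodule.span R (A.col '' t)) :=
      Module.Finite.span_of_finite R (Set.toFinite _)
    refine Submodule.finrank_mono (Submodule.span_le.mpr ?_)
    rintro _ ⟨j, rfl⟩
    have : ((∏ j, a j) • A).col j = (∏ i ∈ Finset.univ.erase j, a i) • a j • A.col j := by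
      rw [smul_smul, Finset.prod_erase_mul _ _ (Finset.mem_univ j)]
      rfl
    rw [this]
    exact Submodule.smul_mem _ _ (ha j)
  obtain ⟨f⟩ : Nonempty (Fin r ↪ t) := Function.Embedding.nonempty_of_card_le (by simpa using hle)
  refine ⟨fun i => f i, det_ne_zero_of_mulVec_injective ?_⟩
  rw [mulVec_injective_iff]
  exact LinearIndependent.comp hind f f.injective

theorem eq_zero_of_mul_eq_zero_of_det_ne_zero {ι κ : Type*} [Fintype κ] [DecidableEq κ]
    {A : Matrix ι κ R} {B : Matrix κ κ R} (hB : B.det ≠ 0) (h : A * B = 0) : A = 0 := by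
  have h2 : B.det • A = 0 := by
    rw [← Matrix.mul_one A, ← Matrix.mul_smul, ← mul_adjugate, ← Matrix.mul_assoc, h,
      Matrix.zero_mul]
  ext i j
  exact (mul_eq_zero.mp (congrFun (congrFun h2 i) j)).resolve_left hB

end Domain

section PID

variable {R : Type*} [CommRing R] [IsDomain R] [IsPrincipalIdealRing R]
variable {ι κ μ : Type*} [Fintype ι] [Fintype κ] [Fintype μ]
  [DecidableEq ι] [DecidableEq κ]

/-- A matrix of full column rank over a principal ideal domain factors as a matrix with a left
inverse times a square matrix. -/
theorem exists_eq_mul_and_left_inverse (S : Matrix μ κ R) (f : κ → μ)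
    (hdet : (S.submatrix f id).det ≠ 0) :
    ∃ (V : Matrix μ κ R) (T : Matrix κ κ R) (U : Matrix κ μ R), S = V * T ∧ U * V = 1 := by
  classical
  let N := LinearMap.range S.vecMulLinear
  have hrank : Module.finrank R N = Fintype.card κ := by
    apply le_antisymm
    · simpa using Submodule.finrank_le N
    · have hind := linearIndependent_rows_of_det_ne_zero hdet
      rw [← finrank_span_eq_card hind]
      refine Submodule.finrank_mono (Submodule.span_le.mpr ?_)
      rintro _ ⟨k, rfl⟩
      exact ⟨Pi.single (f k) 1, by simp; rfl⟩
  let b : Module.Basis κ R N :=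
    (Module.finBasisOfFinrankEq R N hrank).reindex (Fintype.equivFin κ).symm
  have hS : ∀ i, S i ∈ N := fun i => ⟨Pi.single i 1, by simp; rfl⟩
  let T : Matrix κ κ R := fun k => (b k : κ → R)
  let V : Matrix μ κ R := fun i => b.repr ⟨S i, hS i⟩
  have hU : ∀ k, ∃ u : μ → R, u ᵥ* S = T k := fun k => (b k).2
  choose U' hU using hU
  let U : Matrix κ μ R := of U'
  have hSVT : S = V * T := by
    ext i j
    have := congrArg (fun x : N => (x : κ → R) j) (b.sum_repr ⟨S i, hS i⟩)
    simp only [Submodule.coe_sum, Submodule.coe_smul, Finset.sum_apply, Pi.smul_apply,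
      smul_eq_mul] at this
    exact this.symm
  refine ⟨V, T, U, hSVT, ?_⟩
  have hT : T.det ≠ 0 := by
    intro h
    apply hdet
    rw [hSVT, submatrix_mul V T f id id Function.bijective_id, det_mul, submatrix_id_id, h,
      mul_zero]
  have hUS : U * S = T := by
    ext k j
    exact congrFun (hU k) j
  rw [← sub_eq_zero]
  refine eq_zero_of_mul_eq_zero_of_det_ne_zero hT ?_
  rw [Matrix.sub_mul, Matrix.one_mul, Matrix.mul_assoc, ← hSVT]
  exact sub_eq_zero.mpr hUS

/-- If the rows of `K` generate the left kernel of `S`, then the minor of `K` on a set of columns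
divides the minor of `S` on the complementary set of rows. -/
theorem det_submatrix_dvd_det_submatrix [DecidableEq μ] (e : ι ⊕ κ ≃ μ) (K : Matrix ι μ R)
    (S : Matrix μ κ R)
    (hdet : (S.submatrix (e ∘ Sum.inr) id).det ≠ 0) (hKS : K * S = 0)
    (hker : ∀ p : μ → R, p ᵥ* S = 0 → ∃ c : ι → R, c ᵥ* K = p) :
    (K.submatrix id (e ∘ Sum.inl)).det ∣ (S.submatrix (e ∘ Sum.inr) id).det := by
  obtain ⟨V, T, U, rfl, hUV⟩ := exists_eq_mul_and_left_inverse S _ hdet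
  have hdetS : ((V * T).submatrix (e ∘ Sum.inr) id).det =
      (V.submatrix (e ∘ Sum.inr) id).det * T.det := by
    rw [submatrix_mul V T _ id id Function.bijective_id, det_mul, submatrix_id_id]
  have hT : T.det ≠ 0 := right_ne_zero_of_mul (hdetS ▸ hdet)
  have hKV : K * V = 0 :=
    eq_zero_of_mul_eq_zero_of_det_ne_zero hT (by rw [Matrix.mul_assoc, hKS])
  have hEV : (1 - V * U) * (V * T) = 0 := by
    rw [← Matrix.mul_assoc, Matrix.sub_mul, Matrix.mul_assoc V, hUV]
    simp
  have hc : ∀ i, ∃ c : ι → R, c ᵥ* K = (1 - V * U : Matrix μ μ R) i := fun i =>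
    hker _ (congrFun hEV i)
  choose C hC using hc
  have hCK : of C * K + V * U = 1 := by
    rw [← eq_sub_iff_add_eq]
    ext i j
    exact congrFun (hC i) j
  have hinv : fromCols (of C) V * fromRows K U = 1 := by
    rw [fromCols_mul_fromRows, hCK]
  have hunit : IsUnit (((fromRows K U).submatrix id e).det) := by
    have h1 : (fromCols (of C) V).submatrix e id * (fromRows K U).submatrix id e = 1 := by
      rw [← submatrix_mul _ _ e id e Function.bijective_id, hinv, submatrix_one_equiv]
    exact IsUnit.of_mul_eq_one_right _ (by rw [← det_mul, h1, det_one])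
  have hblocks : (fromRows K U).submatrix id e *
      fromBlocks 1 (V.submatrix (e ∘ Sum.inl) id) 0 (V.submatrix (e ∘ Sum.inr) id) =
      fromBlocks (K.submatrix id (e ∘ Sum.inl)) 0 (U.submatrix id (e ∘ Sum.inl)) 1 := by
    have h1 : (fromRows K U).submatrix id e =
        fromBlocks (K.submatrix id (e ∘ Sum.inl)) (K.submatrix id (e ∘ Sum.inr))
          (U.submatrix id (e ∘ Sum.inl)) (U.submatrix id (e ∘ Sum.inr)) := by
      ext (i | i) (j | j) <;> rfl
    rw [h1, fromBlocks_multiply, submatrix_mul_add_submatrix_mul e,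
      submatrix_mul_add_submatrix_mul e, hKV, hUV]
    simp
  have hdets := congrArg det hblocks
  rw [det_mul, det_fromBlocks_zero₂₁, det_fromBlocks_zero₁₂, det_one, det_one, one_mul,
    mul_one] at hdets
  rw [hdetS, ← hdets]
  exact hunit.mul_left_dvd.mpr (dvd_mul_right _ _)

end PID

end Matrix
namespace PolyMat

open Polynomial

variable {𝕜 : Type*} [Field 𝕜] {k m n r : ℕ}

theorem deg_eq_bot {p : 𝕜[X]} : deg p = ⊥ ↔ p = 0 := by
  rw [deg, WithBot.map_eq_bot_iff, degree_eq_bot]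

theorem deg_zero : deg (0 : 𝕜[X]) = ⊥ := deg_eq_bot.mpr rfl

theorem deg_of_degree_eq {p : 𝕜[X]} {d : ℕ} (h : p.degree = d) : deg p = ((d : ℤ) : WithBot ℤ) := by
  rw [deg, h]
  rfl

theorem deg_of_ne_zero {p : 𝕜[X]} (h : p ≠ 0) : deg p = ((p.natDegree : ℤ) : WithBot ℤ) :=
  deg_of_degree_eq (degree_eq_natDegree h)

theorem deg_le_deg {p q : 𝕜[X]} : deg p ≤ deg q ↔ p.degree ≤ q.degree :=
  WithBot.map_le_iff _ (fun {a b} => by simp)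

theorem deg_le_of_dvd {p q : 𝕜[X]} (h : p ∣ q) (hq : q ≠ 0) : deg p ≤ deg q :=
  deg_le_deg.mpr (degree_le_of_dvd h hq)

theorem deg_one : deg (1 : 𝕜[X]) = 0 := deg_of_degree_eq (d := 0) (by simp)

theorem deg_mul (p q : 𝕜[X]) : deg (p * q) = deg p + deg q := by
  by_cases hp : p = 0
  · simp [hp, deg_zero]
  by_cases hq : q = 0
  · simp [hq, deg_zero]
  rw [deg_of_ne_zero hp, deg_of_ne_zero hq, deg_of_ne_zero (mul_ne_zero hp hq),
    natDegree_mul hp hq]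
  push_cast
  rfl

theorem deg_prod {ι : Type*} (t : Finset ι) (f : ι → 𝕜[X]) :
    deg (∏ i ∈ t, f i) = ∑ i ∈ t, deg (f i) := by
  classical
  induction t using Finset.induction_on with
  | empty => simp [deg_one]
  | insert a t ha ih => rw [Finset.prod_insert ha, Finset.sum_insert ha, deg_mul, ih]

theorem deg_units_smul (u : ℤˣ) (p : 𝕜[X]) : deg (u • p) = deg p := by
  rcases Int.units_eq_one_or u with rfl | rfl <;> simp [deg, Units.smul_def]

theorem deg_add_le (p q : 𝕜[X]) : deg (p + q) ≤ max (deg p) (deg q) := by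
  rcases le_max_iff.mp (degree_add_le p q) with h | h
  · exact le_max_of_le_left (deg_le_deg.mpr h)
  · exact le_max_of_le_right (deg_le_deg.mpr h)

theorem deg_sum_le {ι : Type*} (t : Finset ι) (f : ι → 𝕜[X]) {b : WithBot ℤ}
    (h : ∀ i ∈ t, deg (f i) ≤ b) : deg (∑ i ∈ t, f i) ≤ b := by
  classical
  induction t using Finset.induction_on with
  | empty => simp [deg_zero]
  | insert a t ha ih =>
    rw [Finset.sum_insert ha]
    exact (deg_add_le _ _).trans (max_le (h a (Finset.mem_insert_self a t))
      (ih fun i hi => h i (Finset.mem_insert_of_mem hi)))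

theorem deg_det_le_sum_rowDeg (A : Matrix (Fin r) (Fin r) 𝕜[X]) :
    deg A.det ≤ ∑ i, rowDeg (A i) := by
  rw [Matrix.det_apply]
  refine deg_sum_le _ _ fun σ _ => ?_
  rw [deg_units_smul, deg_prod, ← Equiv.sum_comp σ fun i => rowDeg (A i)]
  exact Finset.sum_le_sum fun i _ => Finset.le_sup (f := fun j => deg (A (σ i) j))
    (Finset.mem_univ i)

theorem rowDeg_comp_le (p : Fin n → 𝕜[X]) (J : Fin r → Fin n) : rowDeg (p ∘ J) ≤ rowDeg p :=
  Finset.sup_le fun j _ => Finset.le_sup (f := fun j => deg (p j)) (Finset.mem_univ (J j))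

/-- A square matrix whose entries are dominated, up to a shift `t`, by the diagonal entries of
their rows, strictly so above the diagonal, has a determinant of the same degree as the product of
its diagonal entries. -/
theorem degree_det_eq_sum {A : Matrix (Fin k) (Fin k) 𝕜[X]} (t : Fin k → ℤ) (δ : Fin k → ℕ)
    (hdiag : ∀ i, (A i i).degree = (δ i : WithBot ℕ))
    (hle : ∀ i j, A i j ≠ 0 → t j + (A i j).natDegree ≤ t i + δ i)
    (hlt : ∀ i j, i < j → A i j ≠ 0 → t j + (A i j).natDegree < t i + δ i) :
    A.det.degree = ((∑ i, δ i : ℕ) : WithBot ℕ) := by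
  have hprod : (∏ i, A i i).degree = ((∑ i, δ i : ℕ) : WithBot ℕ) := by
    rw [degree_prod, Finset.sum_congr rfl fun i _ => hdiag i]
    simp
  rw [Matrix.det_apply, ← Finset.add_sum_erase _ _ (Finset.mem_univ (1 : Equiv.Perm (Fin k)))]
  simp only [Equiv.Perm.sign_one, one_smul, Equiv.Perm.one_apply]
  rw [degree_add_eq_left_of_degree_lt, hprod]
  rw [hprod]
  refine (degree_sum_le _ _).trans_lt ((Finset.sup_lt_iff (WithBot.bot_lt_coe _)).mpr ?_)
  intro σ hσ
  have hσ1 : σ ≠ 1 := (Finset.mem_erase.mp hσ).1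
  have hsmul : (Equiv.Perm.sign σ • ∏ i, A (σ i) i).degree = (∏ i, A (σ i) i).degree := by
    rcases Int.units_eq_one_or (Equiv.Perm.sign σ) with h | h <;> simp [h, Units.smul_def]
  rw [hsmul]
  by_cases h0 : ∏ i, A (σ i) i = 0
  · rw [h0, degree_zero]
    exact WithBot.bot_lt_coe _
  have hne : ∀ i, A (σ i) i ≠ 0 := fun i => Finset.prod_ne_zero_iff.mp h0 i (Finset.mem_univ i)
  obtain ⟨i, hi⟩ : ∃ i, σ i < i := by
    by_contra! hcon
    apply hσ1
    ext i
    have hsum : ∑ i, ((σ i : ℕ)) = ∑ i : Fin k, (i : ℕ) :=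
      Equiv.sum_comp σ fun i : Fin k => (i : ℕ)
    have := (Finset.sum_eq_sum_iff_of_le fun i _ => Fin.le_def.mp (hcon i)).mp hsum.symm i
      (Finset.mem_univ i)
    simpa using this.symm
  rw [degree_eq_natDegree h0, natDegree_prod _ _ fun i _ => hne i]
  have hsum : ∑ i, (t i + ((A (σ i) i).natDegree : ℤ)) < ∑ i, (t (σ i) + (δ (σ i) : ℤ)) :=
    Finset.sum_lt_sum (fun i _ => hle _ _ (hne i)) ⟨i, Finset.mem_univ i, hlt _ _ hi (hne i)⟩
  rw [Equiv.sum_comp σ fun i => t i + (δ i : ℤ), Finset.sum_add_distrib, Finset.sum_add_distrib,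
    add_lt_add_iff_left] at hsum
  exact_mod_cast hsum

theorem IsPivotIndex.unique {s : Fin n → ℤ} {p : Fin n → 𝕜[X]} {i j : Fin n}
    (hi : IsPivotIndex s p i) (hj : IsPivotIndex s p j) : i = j :=
  hi.2.unique hj.2

theorem IsPivotIndex.shiftedRowDeg_eq {s : Fin n → ℤ} {p : Fin n → 𝕜[X]} {j : Fin n}
    (h : IsPivotIndex s p j) {d : ℕ} (hd : (p j).degree = d) :
    shiftedRowDeg s p = ((s j + d : ℤ) : WithBot ℤ) := by
  have : (s j : WithBot ℤ) + deg (p j) = shiftedRowDeg s p := h.2.1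
  rw [← this, deg_of_degree_eq hd]
  rfl

theorem IsPivotIndex.natDegree_le {s : Fin n → ℤ} {p : Fin n → 𝕜[X]} {j : Fin n}
    (h : IsPivotIndex s p j) {d : ℕ} (hd : (p j).degree = d) (l : Fin n) (hl : p l ≠ 0) :
    s l + (p l).natDegree ≤ s j + d := by
  have h1 : (s l : WithBot ℤ) + deg (p l) ≤ shiftedRowDeg s p :=
    Finset.le_sup (f := fun l => (s l : WithBot ℤ) + deg (p l)) (Finset.mem_univ l)
  rw [h.shiftedRowDeg_eq hd, deg_of_ne_zero hl] at h1
  exact_mod_cast h1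

theorem IsPivotIndex.natDegree_lt {s : Fin n → ℤ} {p : Fin n → 𝕜[X]} {j : Fin n}
    (h : IsPivotIndex s p j) {d : ℕ} (hd : (p j).degree = d) (l : Fin n) (hjl : j < l)
    (hl : p l ≠ 0) : s l + (p l).natDegree < s j + d := by
  refine lt_of_le_of_ne (h.natDegree_le hd l hl) fun heq => ?_
  have hmem : l ∈ {l | (s l : WithBot ℤ) + deg (p l) = shiftedRowDeg s p} := by
    rw [Set.mem_ofPred_eq, h.shiftedRowDeg_eq hd, deg_of_ne_zero hl, ← heq]
    rfl
  exact absurd (h.2.2 hmem) (not_le.mpr hjl)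

/-- The pivot columns of a matrix in weak Popov form give a minor whose degree is the sum of the
pivot degrees. -/
theorem IsPivotProfile.degree_det {s : Fin n → ℤ} {P : Matrix (Fin k) (Fin n) 𝕜[X]}
    {π : Fin k → Fin n} {δ : Fin k → ℕ} (h : IsPivotProfile s P π δ) (hπ : StrictMono π) :
    (P.submatrix id π).det.degree = ((∑ i, δ i : ℕ) : WithBot ℕ) :=
  degree_det_eq_sum (fun i => s (π i)) δ (fun i => (h i).2)
    (fun i j => (h i).1.natDegree_le (h i).2 (π j))
    (fun i j hij => (h i).1.natDegree_lt (h i).2 (π j) (hπ hij))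

theorem IsPivotProfile.strictMono {s : Fin n → ℤ} {P : Matrix (Fin k) (Fin n) 𝕜[X]}
    {π : Fin k → Fin n} {δ : Fin k → ℕ} (h : IsPivotProfile s P π δ) (hP : IsWeakPopov s P) :
    StrictMono π := by
  obtain ⟨-, π', hπ', hmono⟩ := hP
  rwa [show π = π' from funext fun i => (h i).1.unique (hπ' i)]

theorem card_complIndices {π : Fin k → Fin m} (hπ : Function.Injective π) (h : k + r = m) :
    (complIndices π).card = r := by
  rw [complIndices, Finset.card_compl, Finset.card_image_of_injective _ hπ, Finset.card_univ,
    Fintype.card_fin, Fintype.card_fin]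
  omega

theorem bijective_sumElim_orderEmbOfFin {π : Fin k → Fin m} (hπ : Function.Injective π)
    (h : k + r = m) (hcard : (complIndices π).card = r) :
    Function.Bijective (Sum.elim π ((complIndices π).orderEmbOfFin hcard)) := by
  refine (Fintype.bijective_iff_injective_and_card _).mpr ⟨?_, by simp [h]⟩
  refine hπ.sumElim (RelEmbedding.injective _) fun i j hij => ?_
  have := (complIndices π).orderEmbOfFin_mem hcard j
  rw [← hij] at this
  simp [complIndices] at this

theorem rank_selectRows_complIndices {F : Matrix (Fin m) (Fin n) 𝕜[X]} (hF : F.rank = r)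
    {K : Matrix (Fin k) (Fin m) 𝕜[X]} {π : Fin k → Fin m} (hπ : Function.Injective π)
    (h : k + r = m) (hcard : (complIndices π).card = r) (hKF : K * F = 0)
    (hdet : (K.submatrix id π).det ≠ 0) :
    (selectRows F (complIndices π) hcard).rank = r := by
  refine le_antisymm (Matrix.rank_le_height _) ?_
  let e := Equiv.ofBijective _ (bijective_sumElim_orderEmbOfFin hπ h hcard)
  let G := selectRows F (complIndices π) hcard
  let K₁ := K.submatrix id π
  let K₂ := K.submatrix id ((complIndices π).orderEmbOfFin hcard)
  have hsum : K₁ * F.submatrix π id + K₂ * G = 0 :=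
    (Matrix.submatrix_mul_add_submatrix_mul e K F).trans hKF
  have h1 : K₁.det • F.submatrix π id = -(K₁.adjugate * K₂) * G := by
    rw [← Matrix.one_mul (F.submatrix π id), ← Matrix.smul_mul, ← Matrix.adjugate_mul,
      Matrix.mul_assoc, eq_neg_of_add_eq_zero_left hsum, Matrix.mul_neg, Matrix.neg_mul,
      Matrix.mul_assoc]
  have h2 : (K₁.det • F).submatrix e id =
      Matrix.fromRows (-(K₁.adjugate * K₂)) (K₁.det • (1 : Matrix (Fin r) (Fin r) 𝕜[X])) * G := by
    rw [Matrix.fromRows_mul, ← h1, Matrix.smul_mul, Matrix.one_mul]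
    ext (i | i) j <;> rfl
  have h3 : (K₁.det • F).rank ≤ G.rank := by
    rw [← Matrix.rank_submatrix _ e (Equiv.refl _)]
    exact (congrArg Matrix.rank h2).trans_le (Matrix.rank_mul_le_right _ _)
  rw [Matrix.rank_smul_of_mem_nonZeroDivisors _ (mem_nonZeroDivisors_of_ne_zero hdet)] at h3
  exact hF.symm.trans_le h3

theorem sum_rowDeg_selectRows_le (F : Matrix (Fin m) (Fin n) 𝕜[X]) (I : Finset (Fin m))
    (hI : I.card = r) : ∑ i, rowDeg (selectRows F I hI i) ≤ r • matDeg F := by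
  have : ∀ i ∈ Finset.univ, rowDeg (selectRows F I hI i) ≤ matDeg F := fun i _ =>
    Finset.le_sup (f := fun i => rowDeg (F i)) (Finset.mem_univ (I.orderEmbOfFin hI i))
  simpa using Finset.sum_le_card_nsmul _ _ _ this

theorem sum_shiftedRowDeg_eq {s : Fin m → ℤ} {K : Matrix (Fin k) (Fin m) 𝕜[X]}
    {π : Fin k → Fin m} {δ : Fin k → ℕ} (h : IsPivotProfile s K π δ) :
    ∑ i, shiftedRowDeg s (K i) =
      ((∑ i, s (π i) : ℤ) : WithBot ℤ) + ((∑ i, (δ i : ℤ) : ℤ) : WithBot ℤ) := by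
  rw [Finset.sum_congr rfl fun i _ => (h i).1.shiftedRowDeg_eq (h i).2, ← WithBot.coe_add,
    ← Finset.sum_add_distrib]
  push_cast
  rfl

end PolyMat

theorem mainTheorem3 {𝕜 : Type*} [Field 𝕜] (m n r : ℕ)
    (F : Matrix (Fin m) (Fin n) (Polynomial 𝕜)) (hF : F.rank = r)
    (s : Fin m → ℤ)
    (K : Matrix (Fin (m - r)) (Fin m) (Polynomial 𝕜))
    (hKbasis : PolyMat.RowsFormBasis K (PolyMat.leftKernel F))
    (hKpopov : PolyMat.IsWeakPopov s K)
    (π : Fin (m - r) → Fin m) (δ : Fin (m - r) → ℕ)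
    (hprofile : PolyMat.IsPivotProfile s K π δ)
    (S : Matrix (Fin m) (Fin r) (Polynomial 𝕜)) (R : Matrix (Fin r) (Fin n) (Polynomial 𝕜))
    (hFSR : F = S * R) :
    ∃ hcard : (PolyMat.complIndices π).card = r,
      -- (i)
      (PolyMat.selectRows F (PolyMat.complIndices π) hcard).rank = r ∧
      -- (ii)
      ((PolyMat.selectRows S (PolyMat.complIndices π) hcard).det ≠ 0 ∧
        (((∑ i, (δ i : ℤ) : ℤ) : WithBot ℤ) ≤
          PolyMat.deg (PolyMat.selectRows S (PolyMat.complIndices π) hcard).det) ∧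
        (PolyMat.deg (PolyMat.selectRows S (PolyMat.complIndices π) hcard).det ≤
          ∑ i, PolyMat.rowDeg (PolyMat.selectRows F (PolyMat.complIndices π) hcard i)) ∧
        (∑ i, PolyMat.rowDeg (PolyMat.selectRows F (PolyMat.complIndices π) hcard i) ≤
          r • PolyMat.matDeg F)) ∧
      -- (iii)
      ((∀ i, PolyMat.rowDeg (F i) ≤ (s i : WithBot ℤ)) →
        ∑ i, PolyMat.shiftedRowDeg s (K i) ≤ ((∑ i, s i : ℤ) : WithBot ℤ)) := by
  have hmono := hprofile.strictMono hKpopov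
  have hrm : m - r + r = m := Nat.sub_add_cancel (hF ▸ F.rank_le_height)
  have hcard := PolyMat.card_complIndices hmono.injective hrm
  have hdegK := hprofile.degree_det hmono
  have hdetK : (K.submatrix id π).det ≠ 0 := fun h0 => by
    rw [h0, Polynomial.degree_zero] at hdegK
    exact WithBot.bot_ne_coe hdegK
  have hKF : K * F = 0 := by
    refine Matrix.ext fun i j => ?_
    have : K i ∈ PolyMat.leftKernel F := hKbasis.2 ▸ Submodule.subset_span ⟨i, rfl⟩
    exact congrFun (LinearMap.mem_ker.mp this) j
  have hrank := PolyMat.rank_selectRows_complIndices hF hmono.injective hrm hcard hKF hdetK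
  obtain ⟨J, hJ⟩ := Matrix.exists_det_submatrix_ne_zero _ hrank
  have hdetF : ((PolyMat.selectRows F (PolyMat.complIndices π) hcard).submatrix id J).det =
      (PolyMat.selectRows S (PolyMat.complIndices π) hcard).det * (R.submatrix id J).det := by
    rw [hFSR, ← Matrix.det_mul]
    rfl
  have hdetS : (PolyMat.selectRows S (PolyMat.complIndices π) hcard).det ≠ 0 :=
    left_ne_zero_of_mul (hdetF ▸ hJ)
  have hdetR : (R.submatrix id J).det ≠ 0 := right_ne_zero_of_mul (hdetF ▸ hJ)
  have hKS : K * S = 0 := by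
    refine Matrix.eq_zero_of_mul_eq_zero_of_det_ne_zero hdetR ?_
    rw [hFSR, ← Matrix.mul_assoc] at hKF
    exact congrArg (fun M => M.submatrix id J) hKF
  have hker : ∀ p, Matrix.vecMul p S = 0 → ∃ c, Matrix.vecMul c K = p := by
    intro p hp
    have hpF : p ∈ PolyMat.leftKernel F := by
      refine LinearMap.mem_ker.mpr ?_
      rw [Matrix.vecMulLinear_apply, hFSR, ← Matrix.vecMul_vecMul, hp, Matrix.zero_vecMul]
    rw [← hKbasis.2] at hpF
    have hrange := range_vecMulLinear K
    change p ∈ Submodule.span _ (Set.range K.row) at hpF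
    rw [← hrange] at hpF
    exact hpF
  have hdvd := Matrix.det_submatrix_dvd_det_submatrix
    (Equiv.ofBijective _ (PolyMat.bijective_sumElim_orderEmbOfFin hmono.injective hrm hcard))
    K S hdetS hKS hker
  have hδ : ((∑ i, (δ i : ℤ) : ℤ) : WithBot ℤ) ≤
      PolyMat.deg (PolyMat.selectRows S (PolyMat.complIndices π) hcard).det := by
    rw [← Nat.cast_sum, ← PolyMat.deg_of_degree_eq hdegK]
    exact PolyMat.deg_le_of_dvd hdvd hdetS
  have hS : PolyMat.deg (PolyMat.selectRows S (PolyMat.complIndices π) hcard).det ≤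
      ∑ i, PolyMat.rowDeg (PolyMat.selectRows F (PolyMat.complIndices π) hcard i) :=
    (PolyMat.deg_le_of_dvd (Dvd.intro _ hdetF.symm) hJ).trans
      ((PolyMat.deg_det_le_sum_rowDeg _).trans
        (Finset.sum_le_sum fun i _ => PolyMat.rowDeg_comp_le _ J))
  refine ⟨hcard, hrank, ⟨hdetS, hδ, hS, PolyMat.sum_rowDeg_selectRows_le _ _ _⟩, fun hs => ?_⟩
  have hsum : ∑ i, s i =
      ∑ i, s (π i) + ∑ i, s ((PolyMat.complIndices π).orderEmbOfFin hcard i) := by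
    rw [← Equiv.sum_comp (Equiv.ofBijective _
      (PolyMat.bijective_sumElim_orderEmbOfFin hmono.injective hrm hcard)), Fintype.sum_sum_type]
    rfl
  rw [PolyMat.sum_shiftedRowDeg_eq hprofile, hsum, WithBot.coe_add]
  refine add_le_add le_rfl (hδ.trans (hS.trans ?_))
  refine (Finset.sum_le_sum fun i _ =>
    hs ((PolyMat.complIndices π).orderEmbOfFin hcard i)).trans_eq ?_
  push_cast
  rfl
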